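/- $MA(\omega_1)$ is the statement that for every nonempty partially ordered set $P$ with the countable chain condition and every family $\mathcal D$ of at most $\aleph_1$ dense subsets of $P$, there is a filter on $P$ that meets every member of $\mathcal D$. A ladder system on $\omega_1$ is a family $L=\{s_\alpha:\alpha\in S\}$, where $S\subseteq\omega_1$ is a stationary set of limit ordinals and each $s_\alpha\subseteq\alpha$ is a cofinal subset of $\alpha$ of order type $\omega$. The space $X_L$ has underlying set $(\omega_1\times\{0\})\cup(S\times\{1\})$; every point $(\beta,0)$ is isolated, and for each $\alpha\in S$ the basic neighborhoods of $(\alpha,1)$ are the sets $\{(\alpha,1)\}\cup(F\times\{0\})$ with $F$ a cofinite subset of $s_\alpha$. Theorem. Assume $MA(\omega_1)$. Then for any two ladder systems $L_1$ and $L_2$ on $\omega_1$, the product space $X_{L_1}\times X_{L_2}$ is hereditarily normal, i.e. every subspace of it is normal (including the $T_1$ axiom). -/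

import Mathlib

/-- Two elements of a forcing poset are compatible if they have a common extension
(smaller elements are stronger conditions). -/
def ForcingCompatible {P : Type*} [Preorder P] (p q : P) : Prop :=
  ∃ r, r ≤ p ∧ r ≤ q

/-- The countable chain condition: every set of pairwise incompatible elements is countable. -/
def IsCCC (P : Type*) [Preorder P] : Prop :=
  ∀ A : Set P, A.Pairwise (fun p q => ¬ ForcingCompatible p q) → A.Countable

/-- Martin's Axiom `MA(ω₁)`: for every nonempty ccc poset `P` and every family `𝒟` of at most `ℵ₁`
dense subsets of `P`, some filter on `P` meets every member of `𝒟`.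
A set is dense when every element of `P` has an element of the set below it (`IsCoinitial`). -/
def MartinsAxiomOmega1 : Prop :=
  ∀ (P : Type) [Preorder P] [Nonempty P], IsCCC P →
    ∀ 𝒟 : Set (Set P), Cardinal.mk 𝒟 ≤ Cardinal.aleph 1 → (∀ D ∈ 𝒟, IsCoinitial D) →
      ∃ G : Order.PFilter P, ∀ D ∈ 𝒟, ((G : Set P) ∩ D).Nonempty

/-- The set of countable ordinals, with its well-order. -/
abbrev Omega1 : Type := (Ordinal.omega.{0} 1).ToType

/-- A ladder system on `ω₁`: a stationary set `dom` of limit ordinals in `ω₁` and, for each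
`α ∈ dom`, a cofinal subset of `α` of order type `ω`, given by its increasing enumeration. -/
structure LadderSystem where
  /-- the set of ordinals that carry a ladder -/
  dom : Set Omega1
  isStationary_dom : IsStationary dom
  isSuccLimit : ∀ α ∈ dom, Order.IsSuccLimit α
  /-- the `n`-th element of the ladder at `α` -/
  ladder : dom → ℕ → Omega1
  strictMono : ∀ α, StrictMono (ladder α)
  ladder_lt : ∀ α n, ladder α n < α
  cofinal : ∀ (α : dom) (β : Omega1), β < α → ∃ n, β ≤ ladder α n

/-- The underlying set `ω₁ × {0} ∪ dom × {1}` of the ladder system space. -/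
inductive LadderSystem.Space (L : LadderSystem) : Type
  /-- the isolated point `(β, 0)` -/
  | base (β : Omega1) : LadderSystem.Space L
  /-- the point `(α, 1)` -/
  | top (α : L.dom) : LadderSystem.Space L

/-- The topology of the ladder system space: the points `(β, 0)` are isolated, and the basic
neighbourhoods of `(α, 1)` are `{(α, 1)} ∪ (F × {0})` with `F` a cofinite subset of the ladder at
`α`. Thus `U` is open iff, whenever `(α, 1) ∈ U`, all but finitely many elements of the ladder
at `α` lie in `U`. -/
instance LadderSystem.instTopologicalSpaceSpace (L : LadderSystem) :
    TopologicalSpace L.Space where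
  IsOpen U := ∀ α : L.dom, Space.top α ∈ U → {n : ℕ | Space.base (L.ladder α n) ∉ U}.Finite
  isOpen_univ := by
    intro α _
    simp
  isOpen_inter := by
    intro U V hU hV α hα
    refine ((hU α hα.1).union (hV α hα.2)).subset ?_
    intro n hn
    by_cases h : Space.base (L.ladder α n) ∈ U
    · exact Or.inr (fun h' => hn ⟨h, h'⟩)
    · exact Or.inl h
  isOpen_sUnion := by
    intro 𝒰 h𝒰 α hα
    obtain ⟨U, hU, hαU⟩ := hα
    refine (h𝒰 U hU α hαU).subset ?_
    intro n hn h
    exact hn ⟨U, hU, h⟩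

/-- A topological space is hereditarily normal if every subspace is normal (including `T₁`). -/
def HereditarilyNormal (X : Type*) [TopologicalSpace X] : Prop :=
  ∀ Y : Set X, T4Space Y

/-! Hereditary normality follows from separating any `A` and `B`, each disjoint from the closure of
the other. Force with finite sets of pairs (point, basic neighbourhood) in which no neighbourhood of
a point of `A` meets one of a point of `B`. Basic neighbourhoods are clopen, so each point can be
added to each condition; a filter meeting these ℵ₁ dense sets yields the two open sets.

The ccc (`isCCC_of_reflection`, `isCCC_freeFinset_clash`) rests on `nhd_inter_mem_traces`: below
`d`, a neighbourhood of a point not of rank `d` leaves one of countably many traces fixed before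
`d`. A member of an uncountable antichain is thus imitated by one living below `d`, and the two are
compatible. -/

namespace Omega1

/-! ### Closure points in ω₁. -/

instance : Nonempty Omega1 := by
  rw [← Cardinal.mk_ne_zero_iff, Cardinal.mk_toType, Ordinal.card_omega]
  exact (Cardinal.aleph_pos 1).ne'

theorem countable_Iio (a : Omega1) : (Set.Iio a).Countable := by
  rw [← Cardinal.le_aleph0_iff_set_countable, ← Order.lt_succ_iff, Cardinal.succ_aleph0]
  simpa [Cardinal.mk_toType] using Cardinal.mk_Iio_lt a (by simp [Cardinal.mk_toType])

theorem countable_Iic (a : Omega1) : (Set.Iic a).Countable := by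
  rw [← Set.Iio_insert]
  exact (countable_Iio a).insert a

theorem exists_gt_of_countable {s : Set Omega1} (hs : s.Countable) : ∃ b, ∀ a ∈ s, a < b := by
  by_contra! h
  have huniv : (Set.univ : Set Omega1) ⊆ ⋃ a ∈ s, Set.Iic a := fun b _ => by
    obtain ⟨a, ha, hab⟩ := h b
    exact Set.mem_biUnion ha hab
  have hc : (Set.univ : Set Omega1).Countable :=
    (hs.biUnion fun a _ => countable_Iic a).mono huniv
  rw [← Cardinal.le_aleph0_iff_set_countable, Cardinal.mk_univ] at hc
  simp [Cardinal.mk_toType] at hc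

/-- Every `g : ω₁ → ω₁` has closure points above any given ordinal. -/
theorem exists_closure_point (g : Omega1 → Omega1) (b : Omega1) :
    ∃ d, b < d ∧ ∀ c < d, g c < d := by
  have hnext (a : Omega1) : ∃ a', ∀ c ≤ a, c < a' ∧ g c < a' := by
    obtain ⟨a', ha'⟩ := exists_gt_of_countable
      ((countable_Iic a).union ((countable_Iic a).image g))
    exact ⟨a', fun c hc => ⟨ha' c (Or.inl hc), ha' _ (Or.inr ⟨c, hc, rfl⟩)⟩⟩
  choose nxt hnxt using hnext
  let u : ℕ → Omega1 := fun n => nxt^[n] b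
  have hu (n : ℕ) : u (n + 1) = nxt (u n) := Function.iterate_succ_apply' nxt n b
  have hne : {d | ∀ n, u n < d}.Nonempty := by
    obtain ⟨d, hd⟩ := exists_gt_of_countable (Set.countable_range u)
    exact ⟨d, fun n => hd _ ⟨n, rfl⟩⟩
  -- The witness is the supremum of the iterates: anything below it is at most some `u n`, so `g`
  -- sends it below `u (n + 1)`.
  obtain ⟨hmin, hlow⟩ := And.intro (wellFounded_lt.min_mem _ hne)
    (fun c hc => wellFounded_lt.not_lt_min {d | ∀ n, u n < d} (x := c) hc)
  refine ⟨wellFounded_lt.min _ hne, hmin 0, fun c hc => ?_⟩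
  obtain ⟨n, hn⟩ : ∃ n, c ≤ u n := by
    by_contra! h
    exact hlow c h hc
  exact ((hnxt (u n) c hn).2.trans_eq (hu n).symm).trans (hmin (n + 1))

/-- A finite set misses some closure point of `g`, uniformly below a fixed bound. -/
theorem exists_bound_closure_point_notMem (g : Omega1 → Omega1) :
    ∃ b, ∀ s : Set Omega1, s.Finite →
      ∃ d ≤ b, d ∉ s ∧ (∃ c, c < d) ∧ ∀ c < d, g c < d := by
  choose f hf hfg using exists_closure_point g
  obtain ⟨a₀⟩ : Nonempty Omega1 := inferInstance
  let u : ℕ → Omega1 := fun n => f^[n] a₀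
  have hu (n : ℕ) : u (n + 1) = f (u n) := Function.iterate_succ_apply' f n a₀
  have hmono : StrictMono u := strictMono_nat_of_lt_succ fun n => by
    rw [hu]
    exact hf _
  obtain ⟨b, hb⟩ := exists_gt_of_countable (Set.countable_range u)
  refine ⟨b, fun s hs => ?_⟩
  -- The shift by one discards `a₀`, which need not be a closure point.
  obtain ⟨_, ⟨n, rfl⟩, hn⟩ := (Set.infinite_range_of_injective
    (hmono.comp (strictMono_id.add_const 1)).injective).exists_notMem_finite hs
  refine ⟨_, (hb _ ⟨n + 1, rfl⟩).le, hn, ⟨u n, hmono (Nat.lt_succ_self n)⟩, ?_⟩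
  simp only [hu]
  exact hfg _

end Omega1

/-! ### Reflection and the ccc. -/

/-- The finite sets that are independent for the relation `R`, ordered by reverse inclusion. -/
def FreeFinset {I : Type} (R : I → I → Prop) : Type :=
  {s : Finset I // ∀ i ∈ s, ∀ j ∈ s, ¬ R i j}

namespace FreeFinset

variable {I : Type} {R : I → I → Prop}

instance : Preorder (FreeFinset R) where
  le s t := t.1 ⊆ s.1
  le_refl _ := Finset.Subset.refl _
  le_trans _ _ _ h₁ h₂ := Finset.Subset.trans h₂ h₁

instance : Nonempty (FreeFinset R) := ⟨⟨∅, by simp⟩⟩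

theorem compatible_of_forall_not {s t : FreeFinset R}
    (h : ∀ i ∈ s.1, ∀ j ∈ t.1, ¬ R i j ∧ ¬ R j i) : ForcingCompatible s t := by
  classical
  refine ⟨⟨s.1 ∪ t.1, fun i hi j hj => ?_⟩, Finset.subset_union_left, Finset.subset_union_right⟩
  rcases Finset.mem_union.1 hi with hi | hi <;> rcases Finset.mem_union.1 hj with hj | hj
  · exact s.2 i hi j hj
  · exact (h i hi j hj).1
  · exact (h j hj i hi).2
  · exact t.2 i hi j hj

/-- A reflection criterion for the countable chain condition: `D d` are countable initial parts of
`I`, and `K c` are countable families of types, such that for all but finitely many `d`, the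
behaviour of `j` towards `D d` is controlled by a type of `j` in `K c` for some `c < d`. -/
theorem isCCC_of_reflection {K : Omega1 → Set (Set I)} (hKc : ∀ c, (K c).Countable)
    (hK : Monotone K) {D : Omega1 → Set I} (hDc : ∀ d, (D d).Countable) (hD : Monotone D)
    (hcover : ∀ i, ∃ d, i ∈ D d) {exc : I → Set Omega1} (hexc : ∀ i, (exc i).Finite)
    (H : ∀ j d, d ∉ exc j → (∃ c, c < d) → ∃ c < d, ∃ T ∈ K c, j ∈ T ∧
      ∀ j' ∈ T, ∀ i ∈ D d, (R i j → R i j') ∧ (R j i → R j' i)) :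
    IsCCC (FreeFinset R) := by
  classical
  intro A hA
  by_contra hAc
  have hbound (s : Set I) (hs : s.Countable) : ∃ d, s ⊆ D d := by
    choose r hr using hcover
    obtain ⟨d, hd⟩ := Omega1.exists_gt_of_countable (hs.image r)
    exact ⟨d, fun i hi => hD (hd _ ⟨i, hi, rfl⟩).le (hr i)⟩
  let realizes (w : FreeFinset R) (τ : Finset (Set I)) : Prop := ∀ T ∈ τ, ∃ i ∈ w.1, i ∈ T
  have hg (c : Omega1) : ∃ d, ∀ τ : Finset (Set I), (τ : Set (Set I)) ⊆ K c →
      (∃ w ∈ A, realizes w τ) → ∃ w ∈ A, realizes w τ ∧ (w.1 : Set I) ⊆ D d := by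
    let Q : Set (Finset (Set I)) := {τ | (τ : Set (Set I)) ⊆ K c ∧ ∃ w ∈ A, realizes w τ}
    have hQ : Q.Countable := by
      refine Set.Countable.mono (fun τ hτ => ?_)
        ((Set.countable_ofPred_finite_subset (hKc c)).preimage Finset.coe_injective)
      exact ⟨τ.finite_toSet, hτ.1⟩
    choose! w hwA hw using fun (τ : Finset (Set I)) (hτ : τ ∈ Q) => hτ.2
    obtain ⟨d, hd⟩ := hbound (⋃ τ ∈ Q, ((w τ).1 : Set I))
      (hQ.biUnion fun τ _ => (w τ).1.countable_toSet)
    refine ⟨d, fun τ h₁ h₂ => ?_⟩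
    have hτ : τ ∈ Q := ⟨h₁, h₂⟩
    exact ⟨w τ, hwA τ hτ, hw τ hτ, fun i hi => hd (Set.mem_biUnion hτ hi)⟩
  choose g hg using hg
  -- `b` precedes the choice of `w'`, so `w'` can be taken outside `D b`; this later forces `w ≠
  -- w'`.
  obtain ⟨b, hb⟩ := Omega1.exists_bound_closure_point_notMem g
  obtain ⟨w', hw'A, hw'b⟩ : ∃ w ∈ A, ¬ (w.1 : Set I) ⊆ D b := by
    by_contra! h
    refine hAc (Set.Countable.mono (fun w hw => ?_)
      ((Set.countable_ofPred_finite_subset (hDc b)).preimage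
        (f := fun w : FreeFinset R => (w.1 : Set I))
        (Finset.coe_injective.comp Subtype.val_injective)))
    exact ⟨w.1.finite_toSet, h w hw⟩
  obtain ⟨d, hdb, hd, hpos, hclosed⟩ := hb (⋃ i ∈ w'.1, exc i)
    (w'.1.finite_toSet.biUnion fun i _ => hexc i)
  simp only [Set.mem_iUnion, not_exists] at hd
  choose! c hcd T hTK hT hTR using fun j (hj : j ∈ w'.1) => H j d (hd j hj) hpos
  obtain ⟨c₀, hc₀d, hc₀⟩ : ∃ c₀ < d, ∀ j ∈ w'.1, c j ≤ c₀ := by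
    rcases w'.1.eq_empty_or_nonempty with he | hne
    · obtain ⟨c₀, hc₀⟩ := hpos
      exact ⟨c₀, hc₀, by simp [he]⟩
    · obtain ⟨j, hj, hmax⟩ := w'.1.exists_max_image c hne
      exact ⟨c j, hcd j hj, hmax⟩
  obtain ⟨w, hwA, hw, hwD⟩ := hg c₀ (w'.1.image T)
    (by
      intro t ht
      obtain ⟨j, hj, rfl⟩ := Finset.mem_image.1 ht
      exact hK (hc₀ j hj) (hTK j hj))
    ⟨w', hw'A, fun t ht => by
      obtain ⟨j, hj, rfl⟩ := Finset.mem_image.1 ht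
      exact ⟨j, hj, hT j hj⟩⟩
  have hwd : (w.1 : Set I) ⊆ D d := hwD.trans (hD (hclosed c₀ hc₀d).le)
  have hne : w ≠ w' := by
    rintro rfl
    exact hw'b (hwd.trans (hD hdb))
  refine hA hwA hw'A hne (compatible_of_forall_not fun i hi j hj => ?_)
  -- A relation between `i` and `j` would transfer to `i` and `j'`, both in the independent set `w`.
  obtain ⟨j', hj'w, hj'⟩ := hw (T j) (Finset.mem_image_of_mem T hj)
  have hR := hTR j hj j' hj' i (hwd hi)
  exact ⟨fun h => w.2 _ hi _ hj'w (hR.1 h), fun h => w.2 _ hj'w _ hi (hR.2 h)⟩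

end FreeFinset

/-! ### Basic neighbourhoods and their traces. -/

namespace LadderSystem

open Set

variable {L : LadderSystem}

theorem isOpen_iff {U : Set L.Space} : IsOpen U ↔
    ∀ α : L.dom, Space.top α ∈ U → {n : ℕ | Space.base (L.ladder α n) ∉ U}.Finite := Iff.rfl

/-- The ordinal that a point of the ladder system space lies over. -/
def rank : L.Space → Omega1
  | .base β => β
  | .top α => α

/-- The basic neighbourhoods of a point. -/
def nhd : L.Space → ℕ → Set L.Space
  | .base β, _ => {.base β}
  | .top α, n => insert (.top α) ((fun k => .base (L.ladder α k)) '' Ici n)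

theorem mem_nhd (x : L.Space) (n : ℕ) : x ∈ nhd x n := by
  cases x <;> simp [nhd]

theorem nhd_anti (x : L.Space) : Antitone (nhd x) := by
  intro m n h
  cases x with
  | base β => exact Subset.rfl
  | top α => exact insert_subset_insert (image_mono (Ici_subset_Ici.2 h))

theorem base_injective : Function.Injective (Space.base : Omega1 → L.Space) :=
  fun _ _ h => Space.base.inj h

theorem base_ladder_injective (α : L.dom) :
    Function.Injective fun n => (Space.base (L.ladder α n) : L.Space) :=
  base_injective.comp (L.strictMono α).injective

theorem finite_ladder_lt (α : L.dom) {d : Omega1} (hd : d < α) :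
    {n | L.ladder α n < d}.Finite := by
  obtain ⟨m, hm⟩ := L.cofinal α d hd
  refine (finite_Iio m).subset fun n hn => ?_
  exact (L.strictMono α).lt_iff_lt.1 (lt_of_lt_of_le hn hm)

theorem rank_le_of_mem_nhd {x y : L.Space} {n : ℕ} (h : y ∈ nhd x n) : rank y ≤ rank x := by
  cases x with
  | base β => rw [mem_singleton_iff.1 h]
  | top α =>
    rcases h with rfl | ⟨k, _, rfl⟩
    · exact le_rfl
    · exact (L.ladder_lt α k).le

theorem finite_nhd_inter_rank_lt {x : L.Space} {d : Omega1} (hd : d < rank x) (n : ℕ) :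
    (nhd x n ∩ {y | rank y < d}).Finite := by
  cases x with
  | base β => exact (finite_singleton _).subset inter_subset_left
  | top α =>
    refine ((finite_ladder_lt α hd).image fun k => Space.base (L.ladder α k)).subset ?_
    rintro y ⟨rfl | ⟨k, _, rfl⟩, hy⟩
    · exact absurd hy hd.not_gt
    · exact ⟨k, hy, rfl⟩

theorem isOpen_nhd (x : L.Space) (n : ℕ) : IsOpen (nhd x n) := by
  rw [isOpen_iff]
  intro α hα
  cases x with
  | base β => simp [nhd] at hα
  | top α' =>
    obtain rfl : α = α' := by simpa [nhd] using hα
    refine (finite_Iio n).subset fun k hk => ?_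
    by_contra h
    exact hk (Or.inr ⟨k, by simpa using h, rfl⟩)

/-- Ladders at distinct ordinals meet in a finite set. -/
theorem isClosed_nhd (x : L.Space) (n : ℕ) : IsClosed (nhd x n) := by
  rw [← isOpen_compl_iff, isOpen_iff]
  intro α hα
  simp only [mem_compl_iff, not_not]
  -- A base point may lie over `α` itself, but its neighbourhood is a singleton.
  have hne : α.1 ≠ rank x ∨ nhd x n = {x} := by
    cases x with
    | base β => exact Or.inr rfl
    | top α' =>
      refine Or.inl fun h => hα ?_
      rw [Subtype.ext h]
      exact mem_nhd _ n
  suffices h : {y ∈ nhd x n | ∃ k, y = Space.base (L.ladder α k)}.Finite from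
    (h.preimage (base_ladder_injective α).injOn).subset fun k hk => ⟨hk, k, rfl⟩
  rcases hne with hne | hx
  · rcases lt_or_gt_of_ne hne with hlt | hgt
    · refine (finite_nhd_inter_rank_lt hlt n).subset ?_
      rintro y ⟨hy, k, rfl⟩
      exact ⟨hy, L.ladder_lt α k⟩
    · obtain ⟨m, hm⟩ := L.cofinal α _ hgt
      refine ((finite_Iic m).image fun k => Space.base (L.ladder α k)).subset ?_
      rintro y ⟨hy, k, rfl⟩
      exact ⟨k, (L.strictMono α).le_iff_le.1 ((rank_le_of_mem_nhd hy).trans hm), rfl⟩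
  · exact (hx ▸ finite_singleton x).subset (sep_subset _ _)

theorem exists_nhd_subset {U : Set L.Space} (hU : IsOpen U) {x : L.Space} (hx : x ∈ U) :
    ∃ n, nhd x n ⊆ U := by
  cases x with
  | base β => exact ⟨0, singleton_subset_iff.2 hx⟩
  | top α =>
    obtain ⟨m, hm⟩ := (isOpen_iff.1 hU α hx).bddAbove
    refine ⟨m + 1, insert_subset hx ?_⟩
    rintro _ ⟨k, hk, rfl⟩
    by_contra h
    have := hm h
    simp only [mem_Ici] at hk
    omega

instance : T1Space L.Space where
  t1 x := by
    rw [← isOpen_compl_iff, isOpen_iff]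
    intro α _
    refine ((finite_singleton x).preimage (base_ladder_injective α).injOn).subset fun k hk => ?_
    simpa using hk

theorem countable_rank_le (c : Omega1) : {x : L.Space | rank x ≤ c}.Countable := by
  refine (((Omega1.countable_Iic c).image Space.base).union
    (((Omega1.countable_Iic c).preimage Subtype.val_injective).image Space.top)).mono ?_
  rintro (β | α) h
  · exact Or.inl ⟨β, h, rfl⟩
  · exact Or.inr ⟨α, h, rfl⟩

theorem mk_space_le (L : LadderSystem) : Cardinal.mk L.Space ≤ Cardinal.aleph 1 := by
  let f : L.Space → Omega1 × Bool
    | .base β => (β, false)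
    | .top α => (α, true)
  have hf : Function.Injective f := by
    rintro (β | α) (β' | α') h
    · simpa [f] using h
    · simp [f] at h
    · simp [f] at h
    · simpa [f, Subtype.ext_iff] using h
  refine (Cardinal.mk_le_of_injective hf).trans ?_
  rw [Cardinal.mk_prod]
  simp only [Cardinal.lift_id, Cardinal.mk_toType, Ordinal.card_omega]
  exact Cardinal.mul_le_of_le (Cardinal.aleph0_le_aleph 1) le_rfl
    ((Cardinal.mk_le_aleph0).trans (Cardinal.aleph0_le_aleph 1))

/-- The countably many possible traces below some ordinal `≤ c` of a basic neighbourhood. -/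
def traces (L : LadderSystem) (c : Omega1) : Set (Set L.Space) :=
  (fun p : L.Space × ℕ => nhd p.1 p.2) '' ({x | rank x ≤ c} ×ˢ univ) ∪
    {S | S.Finite ∧ S ⊆ {x | rank x ≤ c}}

theorem countable_traces (c : Omega1) : (traces L c).Countable :=
  (((countable_rank_le c).prod countable_univ).image _).union
    (countable_ofPred_finite_subset (countable_rank_le c))

theorem traces_mono : Monotone (traces L) := by
  intro c d h
  have hsub : {x : L.Space | rank x ≤ c} ⊆ {x | rank x ≤ d} := fun x hx => le_trans hx h
  exact union_subset_union (image_mono (prod_mono hsub Subset.rfl))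
    fun S hS => ⟨hS.1, hS.2.trans hsub⟩

/-- Below `d` the neighbourhood is either whole or finite. Rank `d` is excluded because the ladder
at `d` is cofinal in `d`. -/
theorem nhd_inter_mem_traces {x : L.Space} (n : ℕ) {d : Omega1} (hx : rank x ≠ d)
    (hd : ∃ c, c < d) : ∃ c < d, nhd x n ∩ {y | rank y < d} ∈ traces L c := by
  rcases lt_or_gt_of_ne hx with hlt | hgt
  · refine ⟨rank x, hlt, Or.inl ⟨(x, n), ⟨le_refl (rank x), mem_univ _⟩, ?_⟩⟩
    exact (inter_eq_left.2 fun y hy => (rank_le_of_mem_nhd hy).trans_lt hlt).symm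
  · have hfin := finite_nhd_inter_rank_lt hgt n
    rcases (nhd x n ∩ {y | rank y < d}).eq_empty_or_nonempty with he | hne
    · obtain ⟨c, hc⟩ := hd
      exact ⟨c, hc, Or.inr (by simp [he])⟩
    · obtain ⟨y, hy, hmax⟩ := exists_max_image _ rank hfin hne
      exact ⟨rank y, hy.2, Or.inr ⟨hfin, hmax⟩⟩

/-! ### The separating poset on the product. -/

variable {L₁ L₂ : LadderSystem}

/-- The basic neighbourhoods of a point of the product. -/
def prodNhd (x : L₁.Space × L₂.Space) (n : ℕ) : Set (L₁.Space × L₂.Space) :=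
  nhd x.1 n ×ˢ nhd x.2 n

theorem mem_prodNhd (x : L₁.Space × L₂.Space) (n : ℕ) : x ∈ prodNhd x n :=
  ⟨mem_nhd _ n, mem_nhd _ n⟩

theorem isOpen_prodNhd (x : L₁.Space × L₂.Space) (n : ℕ) : IsOpen (prodNhd x n) :=
  (isOpen_nhd _ n).prod (isOpen_nhd _ n)

theorem isClosed_prodNhd (x : L₁.Space × L₂.Space) (n : ℕ) : IsClosed (prodNhd x n) :=
  (isClosed_nhd _ n).prod (isClosed_nhd _ n)

theorem exists_prodNhd_subset {U : Set (L₁.Space × L₂.Space)} (hU : IsOpen U)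
    {x : L₁.Space × L₂.Space} (hx : x ∈ U) : ∃ n, prodNhd x n ⊆ U := by
  obtain ⟨U₁, U₂, h₁, h₂, hx₁, hx₂, h⟩ := isOpen_prod_iff.1 hU x.1 x.2 hx
  obtain ⟨n₁, hn₁⟩ := exists_nhd_subset h₁ hx₁
  obtain ⟨n₂, hn₂⟩ := exists_nhd_subset h₂ hx₂
  exact ⟨max n₁ n₂, (prod_mono ((nhd_anti _ (le_max_left _ _)).trans hn₁)
    ((nhd_anti _ (le_max_right _ _)).trans hn₂)).trans h⟩

/-- The points of `A ∪ B` with a basic neighbourhood that misses the other one of `A` and `B`. -/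
def Item (A B : Set (L₁.Space × L₂.Space)) : Type :=
  {i : (L₁.Space × L₂.Space) × ℕ //
    i.1 ∈ A ∧ Disjoint (prodNhd i.1 i.2) B ∨ i.1 ∈ B ∧ Disjoint (prodNhd i.1 i.2) A}

namespace Item

variable {A B : Set (L₁.Space × L₂.Space)}

/-- The point of an item. -/
def pt (i : Item A B) : L₁.Space × L₂.Space := i.1.1

/-- The neighbourhood of an item. -/
def nhds (i : Item A B) : Set (L₁.Space × L₂.Space) := prodNhd i.1.1 i.1.2

theorem pt_mem_nhds (i : Item A B) : i.pt ∈ i.nhds := mem_prodNhd _ _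

theorem disjoint_right (hAB : Disjoint A B) {i : Item A B} (hi : i.pt ∈ A) :
    Disjoint i.nhds B :=
  i.2.elim And.right fun h => (hAB.ne_of_mem hi h.1 rfl).elim

theorem disjoint_left (hAB : Disjoint A B) {i : Item A B} (hi : i.pt ∈ B) :
    Disjoint i.nhds A :=
  i.2.elim (fun h => (hAB.ne_of_mem h.1 hi rfl).elim) And.right

/-- Two items clash if the neighbourhood of a point of `A` meets that of a point of `B`. -/
def Clash (i j : Item A B) : Prop :=
  i.pt ∈ A ∧ j.pt ∈ B ∧ (i.nhds ∩ j.nhds).Nonempty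

/-- The items both of whose coordinates have rank below `d`. -/
def below (A B : Set (L₁.Space × L₂.Space)) (d : Omega1) : Set (Item A B) :=
  {i | rank i.pt.1 < d ∧ rank i.pt.2 < d}

theorem countable_below (d : Omega1) : (below A B d).Countable := by
  refine Countable.mono (fun i hi => ?_) ((((countable_rank_le (L := L₁) d).prod
    (countable_rank_le (L := L₂) d)).prod (countable_univ (α := ℕ))).preimage
    (f := fun i : Item A B => i.1) Subtype.val_injective)
  exact ⟨⟨hi.1.le, hi.2.le⟩, mem_univ _⟩

/-- The items on prescribed sides whose neighbourhood contains a given rectangle of traces. -/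
def types (A B : Set (L₁.Space × L₂.Space)) (c : Omega1) : Set (Set (Item A B)) :=
  (fun p : (Prop × Prop) × Set L₁.Space × Set L₂.Space =>
    {i | (i.pt ∈ A ↔ p.1.1) ∧ (i.pt ∈ B ↔ p.1.2) ∧ p.2.1 ×ˢ p.2.2 ⊆ i.nhds}) ''
    (univ ×ˢ traces L₁ c ×ˢ traces L₂ c)

theorem isCCC_freeFinset_clash (A B : Set (L₁.Space × L₂.Space)) :
    IsCCC (FreeFinset (Clash (A := A) (B := B))) := by
  refine FreeFinset.isCCC_of_reflection (K := types A B) (D := below A B)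
    (exc := fun i => {rank i.pt.1, rank i.pt.2})
    (fun c => ((countable_univ).prod ((countable_traces c).prod (countable_traces c))).image _)
    (fun c d h => image_mono (prod_mono Subset.rfl (prod_mono (traces_mono h) (traces_mono h))))
    countable_below (fun c d h i hi => ⟨hi.1.trans_le h, hi.2.trans_le h⟩) (fun i => ?_)
    (fun i => toFinite _) (fun j d hj hpos => ?_)
  · obtain ⟨d, hd⟩ := Omega1.exists_gt_of_countable
      (toFinite {rank i.pt.1, rank i.pt.2}).countable
    exact ⟨d, hd _ (by simp), hd _ (by simp)⟩
  · simp only [mem_insert_iff, mem_singleton_iff, not_or] at hj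
    obtain ⟨c₁, hc₁, h₁⟩ := nhd_inter_mem_traces j.1.2 (Ne.symm hj.1) hpos
    obtain ⟨c₂, hc₂, h₂⟩ := nhd_inter_mem_traces j.1.2 (Ne.symm hj.2) hpos
    refine ⟨max c₁ c₂, max_lt hc₁ hc₂, _, ⟨((j.pt ∈ A, j.pt ∈ B), _, _),
      ⟨mem_univ _, traces_mono (le_max_left _ _) h₁, traces_mono (le_max_right _ _) h₂⟩, rfl⟩,
      ⟨Iff.rfl, Iff.rfl, prod_mono inter_subset_left inter_subset_left⟩, ?_⟩
    rintro j' ⟨hA, hB, hsub⟩ i hi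
    -- All of `i.nhds` has both ranks below `d`, so the overlap lies in the rectangle of traces of
    -- `j`.
    have key : i.nhds ∩ j.nhds ⊆ j'.nhds := fun z hz => hsub
      ⟨⟨hz.2.1, (rank_le_of_mem_nhd hz.1.1).trans_lt hi.1⟩,
        ⟨hz.2.2, (rank_le_of_mem_nhd hz.1.2).trans_lt hi.2⟩⟩
    refine ⟨?_, ?_⟩
    · rintro ⟨hiA, hjB, z, hz⟩
      exact ⟨hiA, hB.2 hjB, z, hz.1, key hz⟩
    · rintro ⟨hjA, hiB, z, hz⟩
      exact ⟨hA.2 hjA, hiB, z, key hz.symm, hz.2⟩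

/-- The conditions that decide a neighbourhood of `x`. -/
def deciding (A B : Set (L₁.Space × L₂.Space)) (x : L₁.Space × L₂.Space) :
    Set (FreeFinset (Clash (A := A) (B := B))) :=
  {p | ∃ i ∈ p.1, i.pt = x}

theorem exists_insert {i : Item A B} {p : FreeFinset (Clash (A := A) (B := B))}
    (hAB : Disjoint A B) (h : ∀ j ∈ p.1, ¬ Clash i j ∧ ¬ Clash j i) :
    ∃ q ∈ deciding A B i.pt, q ≤ p := by
  have hi : ¬ Clash i i := fun h => hAB.ne_of_mem h.1 h.2.1 rfl
  obtain ⟨q, hq, hqp⟩ := FreeFinset.compatible_of_forall_not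
    (s := ⟨{i}, by simpa using hi⟩) (t := p) (by simpa using h)
  exact ⟨q, ⟨i, hq (by simp), rfl⟩, hqp⟩

theorem isCoinitial_deciding (h₁ : Disjoint (closure A) B) (h₂ : Disjoint A (closure B))
    {x : L₁.Space × L₂.Space} (hx : x ∈ A ∪ B) : IsCoinitial (deciding A B x) := by
  have hAB : Disjoint A B := h₁.mono_left subset_closure
  intro p
  rcases hx with hx | hx
  -- Avoiding `closure B` makes the new pair an item; avoiding the finite union prevents clashes
  -- with `p`.
  · have hclosed : IsClosed (closure B ∪ ⋃ j ∈ {j | j ∈ p.1 ∧ j.pt ∈ B}, j.nhds) :=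
      isClosed_closure.union ((p.1.finite_toSet.subset fun j hj => hj.1).isClosed_biUnion
        fun j _ => isClosed_prodNhd _ _)
    obtain ⟨n, hn⟩ := exists_prodNhd_subset hclosed.isOpen_compl (x := x) (by
      rintro (h | h)
      · exact h₂.ne_of_mem hx h rfl
      · obtain ⟨j, hj, hxj⟩ := mem_iUnion₂.1 h
        exact (disjoint_left hAB hj.2).ne_of_mem hxj hx rfl)
    rw [subset_compl_iff_disjoint_right, disjoint_union_right] at hn
    refine exists_insert (i := ⟨(x, n), Or.inl ⟨hx, hn.1.mono_right subset_closure⟩⟩) hAB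
      fun j hj => ⟨?_, fun h => hAB.ne_of_mem hx h.2.1 rfl⟩
    rintro ⟨-, hjB, z, hz⟩
    exact hn.2.ne_of_mem hz.1 (mem_biUnion (show j ∈ {j | j ∈ p.1 ∧ j.pt ∈ B} from ⟨hj, hjB⟩) hz.2)
      rfl
  · have hclosed : IsClosed (closure A ∪ ⋃ j ∈ {j | j ∈ p.1 ∧ j.pt ∈ A}, j.nhds) :=
      isClosed_closure.union ((p.1.finite_toSet.subset fun j hj => hj.1).isClosed_biUnion
        fun j _ => isClosed_prodNhd _ _)
    obtain ⟨n, hn⟩ := exists_prodNhd_subset hclosed.isOpen_compl (x := x) (by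
      rintro (h | h)
      · exact h₁.ne_of_mem h hx rfl
      · obtain ⟨j, hj, hxj⟩ := mem_iUnion₂.1 h
        exact (disjoint_right hAB hj.2).ne_of_mem hxj hx rfl)
    rw [subset_compl_iff_disjoint_right, disjoint_union_right] at hn
    refine exists_insert (i := ⟨(x, n), Or.inr ⟨hx, hn.1.mono_right subset_closure⟩⟩) hAB
      fun j hj => ⟨fun h => hAB.ne_of_mem h.1 hx rfl, ?_⟩
    rintro ⟨hjA, -, z, hz⟩
    exact hn.2.ne_of_mem hz.2 (mem_biUnion (show j ∈ {j | j ∈ p.1 ∧ j.pt ∈ A} from ⟨hj, hjA⟩) hz.1)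
      rfl

end Item

/-! ### Separation from the filter. -/

theorem completelyNormalSpace_prod (hMA : MartinsAxiomOmega1) (L₁ L₂ : LadderSystem) :
    CompletelyNormalSpace (L₁.Space × L₂.Space) where
  completely_normal A B h₁ h₂ := by
    have hcard : Cardinal.mk (Item.deciding A B '' (A ∪ B)) ≤ Cardinal.aleph 1 := by
      refine Cardinal.mk_image_le.trans ((Cardinal.mk_set_le _).trans ?_)
      rw [Cardinal.mk_prod]
      simp only [Cardinal.lift_id]
      exact Cardinal.mul_le_of_le (Cardinal.aleph0_le_aleph 1) (mk_space_le L₁) (mk_space_le L₂)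
    obtain ⟨G, hG⟩ := hMA _ (Item.isCCC_freeFinset_clash A B) (Item.deciding A B '' (A ∪ B))
      hcard (by
        rintro _ ⟨x, hx, rfl⟩
        exact Item.isCoinitial_deciding h₁ h₂ hx)
    rw [← separatedNhds_iff_disjoint]
    refine ⟨⋃ i ∈ {i : Item A B | i.pt ∈ A ∧ ∃ p ∈ G, i ∈ p.1}, i.nhds,
      ⋃ i ∈ {i : Item A B | i.pt ∈ B ∧ ∃ p ∈ G, i ∈ p.1}, i.nhds,
      isOpen_biUnion fun i _ => isOpen_prodNhd _ _,
      isOpen_biUnion fun i _ => isOpen_prodNhd _ _, fun x hx => ?_, fun x hx => ?_, ?_⟩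
    · obtain ⟨p, hpG, i, hip, rfl⟩ := hG _ ⟨x, Or.inl hx, rfl⟩
      exact mem_biUnion (show i ∈ {i : Item A B | _} from ⟨hx, p, hpG, hip⟩) i.pt_mem_nhds
    · obtain ⟨p, hpG, i, hip, rfl⟩ := hG _ ⟨x, Or.inr hx, rfl⟩
      exact mem_biUnion (show i ∈ {i : Item A B | _} from ⟨hx, p, hpG, hip⟩) i.pt_mem_nhds
    · simp only [disjoint_iUnion_left, disjoint_iUnion_right]
      rintro j ⟨hjB, q, hq, hjq⟩ i ⟨hiA, p, hp, hip⟩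
      -- A common extension contains both items, so they cannot clash.
      obtain ⟨r, -, hrp, hrq⟩ := G.directed p hp q hq
      rw [disjoint_iff_inter_eq_empty, ← not_nonempty_iff_eq_empty]
      exact fun h => r.2 i (hrp hip) j (hrq hjq) ⟨hiA, hjB, h⟩

end LadderSystem

theorem theorem4p19 (hMA : MartinsAxiomOmega1) (L₁ L₂ : LadderSystem) :
    HereditarilyNormal (L₁.Space × L₂.Space) := by
  have := LadderSystem.completelyNormalSpace_prod hMA L₁ L₂
  have : T5Space (L₁.Space × L₂.Space) := {}
  intro Y
  infer_instance
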